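/- For $\alpha,\theta\in\mathbb{R}$ let $H_{\alpha,\theta}$ be the critical almost Mathieu (Harper) operator on $\ell^2(\mathbb{Z})$, $$(H_{\alpha,\theta}\varphi)(n)=\varphi(n-1)+\varphi(n+1)+2\cos\bigl(2\pi(\alpha n+\theta)\bigr)\,\varphi(n),$$ and let $S(\alpha)=\bigcup_{\theta\in[0,1)}\sigma(H_{\alpha,\theta})\subset\mathbb{R}$ be the union of the spectra over the phase $\theta$. Then for all coprime positive integers $p_0$ and $q_0$, the Lebesgue measure of $S(p_0/q_0)$ satisfies $$\left|S\!\left(\frac{p_0}{q_0}\right)\right|\le\frac{4\pi}{q_0}.$$ -/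

import Mathlib

open scoped lp

noncomputable section

namespace Harper

/-- Translates of a square-summable sequence are square-summable. -/
theorem memlp_shift (k : ℤ) (φ : ℓ²(ℤ, ℂ)) : Memℓp (fun n : ℤ => φ (n + k)) 2 := by
  have h := (memℓp_gen_iff (p := 2) (by norm_num)).1 (lp.memℓp φ)
  exact memℓp_gen ((Equiv.addRight k).summable_iff.2 h)

/-- The shift `(T_k φ)(n) = φ (n + k)`, a linear isometry of `ℓ²(ℤ)`. -/
def shift (k : ℤ) : ℓ²(ℤ, ℂ) →ₗᵢ[ℂ] ℓ²(ℤ, ℂ) where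
  toFun φ := ⟨fun n => φ (n + k), memlp_shift k φ⟩
  map_add' _ _ := rfl
  map_smul' _ _ := rfl
  norm_map' φ := by
    change ‖(⟨fun n => φ (n + k), memlp_shift k φ⟩ : ℓ²(ℤ, ℂ))‖ = ‖φ‖
    rw [lp.norm_eq_tsum_rpow (by norm_num), lp.norm_eq_tsum_rpow (by norm_num)]
    congr 1
    exact (Equiv.addRight k).tsum_eq fun n => ‖φ n‖ ^ (2 : ENNReal).toReal

/-- The potential `2 cos (2π(αn + θ))`. -/
def potential (α θ : ℝ) (n : ℤ) : ℝ := 2 * Real.cos (2 * Real.pi * (α * n + θ))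

theorem norm_potential_mul_le (α θ : ℝ) (n : ℤ) (z : ℂ) :
    ‖(potential α θ n : ℂ) * z‖ ≤ ‖(2 : ℂ) * z‖ := by
  rw [norm_mul, norm_mul, Complex.norm_real, Complex.norm_ofNat]
  refine mul_le_mul_of_nonneg_right ?_ (norm_nonneg z)
  rw [potential, norm_mul, Real.norm_eq_abs, Real.norm_eq_abs, abs_two]
  linarith [Real.abs_cos_le_one (2 * Real.pi * (α * n + θ))]

theorem memlp_potential_mul (α θ : ℝ) (φ : ℓ²(ℤ, ℂ)) :
    Memℓp (fun n : ℤ => (potential α θ n : ℂ) * φ n) 2 :=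
  ((lp.memℓp φ).const_smul (2 : ℂ)).norm.mono (g := fun n => ‖(2 : ℂ) * φ n‖)
    fun n => norm_potential_mul_le α θ n (φ n)

/-- Multiplication by the potential, a bounded operator on `ℓ²(ℤ)`. -/
def mulPotential (α θ : ℝ) : ℓ²(ℤ, ℂ) →L[ℂ] ℓ²(ℤ, ℂ) :=
  LinearMap.mkContinuous
    { toFun := fun φ => ⟨fun n => (potential α θ n : ℂ) * φ n, memlp_potential_mul α θ φ⟩
      map_add' := fun φ ψ => lp.ext (funext fun n => mul_add _ (φ n) (ψ n))
      map_smul' := fun c φ => lp.ext (funext fun n => mul_left_comm _ c (φ n)) }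
    2
    (fun φ => by
      have h := lp.norm_const_smul (p := 2) (by norm_num) (c := (2 : ℂ)) φ
      rw [Complex.norm_ofNat] at h
      rw [← h]
      exact lp.norm_mono (by norm_num) fun n => norm_potential_mul_le α θ n (φ n))

/-- The critical almost Mathieu (Harper) operator `H_{α,θ}` on `ℓ²(ℤ)`. -/
def H (α θ : ℝ) : ℓ²(ℤ, ℂ) →L[ℂ] ℓ²(ℤ, ℂ) :=
  (shift (-1)).toContinuousLinearMap + (shift 1).toContinuousLinearMap + mulPotential α θ

/-- The defining formula of the operator. -/
theorem H_apply (α θ : ℝ) (φ : ℓ²(ℤ, ℂ)) (n : ℤ) :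
    H α θ φ n = φ (n - 1) + φ (n + 1)
      + ((2 * Real.cos (2 * Real.pi * (α * n + θ)) : ℝ) : ℂ) * φ n := rfl

/-- The union over `θ ∈ [0, 1)` of the spectra of `H_{α,θ}`, as a set of real numbers
(each `H_{α,θ}` is self-adjoint, so that its spectrum in `ℂ` lies on the real axis). -/
def S (α : ℝ) : Set ℝ :=
  ⋃ θ ∈ Set.Ico (0 : ℝ) 1, {E : ℝ | (E : ℂ) ∈ spectrum ℂ (H α θ)}

end Harper

end

/-! At α = p/q the operator is governed by q × q Floquet matrices u + u⁻¹ + v + v⁻¹, where u, v are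
unitary and uv = ωvu with ω a primitive q-th root of unity. Chambers' relation (`charpoly_weylSum`)
says that the characteristic polynomial of such a sum depends on the pair only in its constant term,
through the scalars u^q and v^q. Hence a single polynomial D (`discr`) satisfies D(H_θ) = T_q +
T_{-q} + 2cos(2πqθ) for every θ (`aeval_H_discr`). The right side has norm at most 4, so spectral
mapping places S inside {|D| ≤ 4}.

The same relation allows another Weyl pair with the same ω. In the chiral gauge both u and v are
weighted cyclic shifts, and the sum is a periodic Jacobi matrix with characteristic polynomial D - 4
for corner factor κ = 1 and D + 4 for κ = -1. So S lies where the product of these two polynomials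
is nonpositive, a set of measure at most ∑ |a_i - b_i| over the ordered eigenvalues
(`volume_prod_mul_prod_nonpos_le`).

The two chiral matrices differ only in the sign of one coupling c between neighbours, and the gauge
makes c = 1 - e^{iπ/q}, so |c| ≤ π/q. Comparing both with a common Hermitian majorant through Weyl
monotonicity (`sum_abs_eigenvalues_sub_le`) gives ∑ |a_i - b_i| ≤ 4|c| ≤ 4π/q. -/

noncomputable section

namespace Harper

open Matrix Finset

/-! ### Eigenvalue comparison and the measure of a sign set. -/

section Weyl

variable {n : Type*} [Fintype n] [DecidableEq n] {A B C : Matrix n n ℂ}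

/-- Weyl monotonicity of eigenvalues of symmetric operators. -/
theorem symmetric_eigenvalues_le {V : Type*} [NormedAddCommGroup V] [InnerProductSpace ℂ V]
    [FiniteDimensional ℂ V] {m : ℕ} (hm : Module.finrank ℂ V = m) {S T : V →ₗ[ℂ] V}
    (hS : S.IsSymmetric) (hT : T.IsSymmetric)
    (h : ∀ x, (inner ℂ (S x) x).re ≤ (inner ℂ (T x) x).re) (i : Fin m) :
    hS.eigenvalues hm i ≤ hT.eigenvalues hm i := by
  set b := hS.eigenvectorBasis hm
  set c := hT.eigenvectorBasis hm
  let U := Submodule.span ℂ (Set.range fun j : {j : Fin m // j ≤ i} => b j)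
  let W := Submodule.span ℂ (Set.range fun j : {j : Fin m // i ≤ j} => c j)
  have hU : Module.finrank ℂ U = i + 1 := by
    refine (finrank_span_eq_card
      (b.orthonormal.linearIndependent.comp _ Subtype.val_injective)).trans ?_
    simp [Fintype.card_subtype, Finset.filter_ge_eq_Iic]
  have hW : Module.finrank ℂ W = m - i := by
    refine (finrank_span_eq_card
      (c.orthonormal.linearIndependent.comp _ Subtype.val_injective)).trans ?_
    simp [Fintype.card_subtype, Finset.filter_le_eq_Ici]
  -- The dimensions add up to m + 1, one more than the whole space.
  have hne : U ⊓ W ≠ ⊥ := by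
    intro h0
    have h1 := Submodule.finrank_sup_add_finrank_inf_eq U W
    have h2 := Submodule.finrank_le (U ⊔ W)
    have := i.2
    rw [h0, finrank_bot] at h1
    omega
  obtain ⟨x, hx, hx0⟩ := Submodule.exists_mem_ne_zero_of_ne_bot hne
  have hbz : ∀ j, i < j → inner ℂ (b j) x = 0 := by
    intro j hj
    refine Submodule.span_induction (p := fun y _ => inner ℂ (b j) y = 0) ?_ ?_ ?_ ?_ hx.1
    · rintro _ ⟨k, rfl⟩
      exact b.orthonormal.2 (ne_of_gt (k.2.trans_lt hj))
    · simp
    · intro y z _ _ hy hz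
      rw [inner_add_right, hy, hz, add_zero]
    · intro a y _ hy
      rw [inner_smul_right, hy, mul_zero]
  have hcz : ∀ j, j < i → inner ℂ (c j) x = 0 := by
    intro j hj
    refine Submodule.span_induction (p := fun y _ => inner ℂ (c j) y = 0) ?_ ?_ ?_ ?_ hx.2
    · rintro _ ⟨k, rfl⟩
      exact c.orthonormal.2 (ne_of_lt (hj.trans_le k.2))
    · simp
    · intro y z _ _ hy hz
      rw [inner_add_right, hy, hz, add_zero]
    · intro a y _ hy
      rw [inner_smul_right, hy, mul_zero]
  have key : ∀ {R : V →ₗ[ℂ] V} (hR : R.IsSymmetric),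
      (inner ℂ (R x) x).re =
        ∑ j, hR.eigenvalues hm j * ‖inner ℂ (hR.eigenvectorBasis hm j) x‖ ^ 2 := by
    intro R hR
    rw [← (hR.eigenvectorBasis hm).sum_inner_mul_inner, Complex.re_sum]
    refine Finset.sum_congr rfl fun j _ => ?_
    rw [hR, hR.apply_eigenvectorBasis, inner_smul_right, ← inner_conj_symm, mul_assoc,
      ← Complex.normSq_eq_conj_mul_self, Complex.normSq_eq_norm_sq]
    exact Complex.re_ofReal_mul _ _
  have nb : ∑ j, ‖inner ℂ (b j) x‖ ^ 2 = ‖x‖ ^ 2 := b.sum_sq_norm_inner_right x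
  have nc : ∑ j, ‖inner ℂ (c j) x‖ ^ 2 = ‖x‖ ^ 2 := c.sum_sq_norm_inner_right x
  -- Eigenvalues are listed in decreasing order, so on U the form of S is bounded below by the i-th
  -- one; dually for T on W.
  have h1 : hS.eigenvalues hm i * ‖x‖ ^ 2 ≤ (inner ℂ (S x) x).re := by
    rw [key hS, ← nb, Finset.mul_sum]
    refine Finset.sum_le_sum fun j _ => ?_
    rcases le_or_gt j i with hj | hj
    · exact mul_le_mul_of_nonneg_right (hS.eigenvalues_antitone hm hj) (by positivity)
    · rw [hbz j hj]; simp
  have h2 : (inner ℂ (T x) x).re ≤ hT.eigenvalues hm i * ‖x‖ ^ 2 := by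
    rw [key hT, ← nc, Finset.mul_sum]
    refine Finset.sum_le_sum fun j _ => ?_
    rcases le_or_gt i j with hj | hj
    · exact mul_le_mul_of_nonneg_right (hT.eigenvalues_antitone hm hj) (by positivity)
    · rw [hcz j hj]; simp
  have hpos : 0 < ‖x‖ ^ 2 := by positivity
  exact le_of_mul_le_mul_right (h1.trans ((h x).trans h2)) hpos

/-- Both eigenvalue lists use the same enumeration of `n` in decreasing order, so comparison at a
common index is the ordered comparison. -/
theorem eigenvalues_le (hA : A.IsHermitian) (hC : C.IsHermitian)
    (h : ∀ x : n → ℂ, (star x ⬝ᵥ A *ᵥ x).re ≤ (star x ⬝ᵥ C *ᵥ x).re) (i : n) :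
    hA.eigenvalues i ≤ hC.eigenvalues i := by
  refine symmetric_eigenvalues_le _ _ _ (fun x => ?_) _
  have key : ∀ M : Matrix n n ℂ, M.IsHermitian → (inner ℂ (toEuclideanLin M x) x).re =
      (star x.ofLp ⬝ᵥ M *ᵥ x.ofLp).re := by
    intro M hM
    rw [(isSymmetric_toEuclideanLin_iff.mpr hM) x x, EuclideanSpace.inner_eq_star_dotProduct,
      dotProduct_comm]
    rfl
  rw [key A hA, key C hC]
  exact h x.ofLp

/-- Two Hermitian matrices with a common upper bound have close ordered eigenvalues. -/
theorem sum_abs_eigenvalues_sub_le (hA : A.IsHermitian) (hB : B.IsHermitian) (hC : C.IsHermitian)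
    (hCA : ∀ x : n → ℂ, (star x ⬝ᵥ A *ᵥ x).re ≤ (star x ⬝ᵥ C *ᵥ x).re)
    (hCB : ∀ x : n → ℂ, (star x ⬝ᵥ B *ᵥ x).re ≤ (star x ⬝ᵥ C *ᵥ x).re) :
    ∑ i, |hA.eigenvalues i - hB.eigenvalues i| ≤ (2 * C.trace - A.trace - B.trace).re := by
  have h : (2 * C.trace - A.trace - B.trace).re =
      ∑ i, ((hC.eigenvalues i - hA.eigenvalues i) + (hC.eigenvalues i - hB.eigenvalues i)) := by
    rw [hA.trace_eq_sum_eigenvalues, hB.trace_eq_sum_eigenvalues, hC.trace_eq_sum_eigenvalues]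
    simp only [Complex.coe_algebraMap, ← Complex.ofReal_sum, Finset.sum_add_distrib,
      Finset.sum_sub_distrib]
    norm_cast
    ring
  rw [h]
  -- With α, β ≤ γ one has |α - β| ≤ (γ - α) + (γ - β).
  refine Finset.sum_le_sum fun i _ => ?_
  have h1 := eigenvalues_le hA hC hCA i
  have h2 := eigenvalues_le hB hC hCB i
  rw [abs_le]
  constructor <;> linarith

/-- Outside every closed interval between a_i and b_i, each (E - a_i)(E - b_i) is positive, hence so
is the product. The intervals therefore cover the set. -/
theorem volume_prod_mul_prod_nonpos_le {ι : Type*} [Fintype ι] (a b : ι → ℝ) :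
    MeasureTheory.volume {E : ℝ | (∏ i, (E - a i)) * ∏ i, (E - b i) ≤ 0} ≤
      ENNReal.ofReal (∑ i, |a i - b i|) := by
  have hsub : {E : ℝ | (∏ i, (E - a i)) * ∏ i, (E - b i) ≤ 0} ⊆
      ⋃ i ∈ (Finset.univ : Finset ι), Set.uIcc (a i) (b i) := by
    intro E hE
    by_contra hcon
    simp only [Finset.mem_univ, Set.iUnion_true, Set.mem_iUnion, not_exists] at hcon
    have : 0 < (∏ i, (E - a i)) * ∏ i, (E - b i) := by
      rw [← Finset.prod_mul_distrib]
      refine Finset.prod_pos fun i _ => ?_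
      have := hcon i
      rw [Set.mem_uIcc] at this
      push Not at this
      rcases lt_or_ge E (a i) with h | h
      · have h2 : E < b i := by
          by_contra h3
          linarith [this.2 (not_lt.1 h3)]
        exact mul_pos_of_neg_of_neg (by linarith) (by linarith)
      · have h2 := this.1 h
        have h3 : a i < E := by
          refine lt_of_le_of_ne h fun h4 => ?_
          exact absurd (this.2 h2.le) (by linarith)
        exact mul_pos (by linarith) (by linarith)
    exact absurd hE (not_le.2 this)
  refine (MeasureTheory.measure_mono hsub).trans
    ((MeasureTheory.measure_biUnion_finset_le _ _).trans ?_)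
  rw [ENNReal.ofReal_sum_of_nonneg fun i _ => abs_nonneg _]
  refine Finset.sum_le_sum fun i _ => ?_
  rw [Set.uIcc, Real.volume_Icc, max_sub_min_eq_abs']

end Weyl

/-! ### Newton's identities: from traces of powers to characteristic polynomials. -/

section Newton

open Polynomial

variable {σ : Type*} [Fintype σ]

/-- By Newton's identities, equal power sums below degree q give equal elementary symmetric
functions below q. The q-th power sum enters only e_q, that is, only the constant term. -/
theorem prod_X_sub_C_of_power_sums (x y : σ → ℂ) (δ : ℂ) (hσ : 0 < Fintype.card σ)
    (hlt : ∀ k, k < Fintype.card σ → ∑ i, x i ^ k = ∑ i, y i ^ k)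
    (heq : ∑ i, y i ^ Fintype.card σ = ∑ i, x i ^ Fintype.card σ + Fintype.card σ * δ) :
    ∏ i, (X - C (y i)) = ∏ i, (X - C (x i)) - C δ := by
  classical
  set q := Fintype.card σ
  let e (z : σ → ℂ) (k : ℕ) : ℂ := MvPolynomial.aeval z (MvPolynomial.esymm σ ℂ k)
  have newton : ∀ (z : σ → ℂ) (k : ℕ), (k : ℂ) * e z k = (-1) ^ (k + 1) *
      ∑ a ∈ antidiagonal k with a.1 < k, (-1) ^ a.1 * e z a.1 * ∑ i, z i ^ a.2 := by
    intro z k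
    have := congrArg (MvPolynomial.aeval z) (MvPolynomial.mul_esymm_eq_sum σ ℂ k)
    simpa [e, MvPolynomial.psum, map_sum] using this
  have elt : ∀ k, k < q → e y k = e x k := by
    intro k
    induction k using Nat.strong_induction_on with
    | _ k ih =>
      intro hk
      rcases Nat.eq_zero_or_pos k with rfl | hk0
      · simp [e]
      have hk' : (k : ℂ) ≠ 0 := by exact_mod_cast hk0.ne'
      refine mul_left_cancel₀ hk' ?_
      rw [newton, newton]
      congr 1
      refine Finset.sum_congr rfl fun a ha => ?_
      rw [mem_filter, HasAntidiagonal.mem_antidiagonal] at ha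
      rw [ih a.1 ha.2 (by omega), hlt a.2 (by omega)]
  have eeq : e y q = e x q + (-1) ^ (q + 1) * δ := by
    have hq' : (q : ℂ) ≠ 0 := by exact_mod_cast hσ.ne'
    refine mul_left_cancel₀ hq' ?_
    rw [mul_add, newton, newton]
    -- The index (0, q) carries the only occurrence of the q-th power sum.
    have : ∀ z, ∑ a ∈ antidiagonal q with a.1 < q, (-1) ^ a.1 * e z a.1 * ∑ i, z i ^ a.2 =
        ∑ i, z i ^ q + ∑ a ∈ ((antidiagonal q).filter (fun a => a.1 < q)).erase (0, q),
          (-1) ^ a.1 * e z a.1 * ∑ i, z i ^ a.2 := by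
      intro z
      rw [← Finset.add_sum_erase _ _ (a := (0, q)) (by simp [hσ])]
      simp [e]
    rw [this y, this x, heq]
    have h2 : ∑ a ∈ ((antidiagonal q).filter (fun a => a.1 < q)).erase (0, q),
          (-1) ^ a.1 * e y a.1 * ∑ i, y i ^ a.2 =
        ∑ a ∈ ((antidiagonal q).filter (fun a => a.1 < q)).erase (0, q),
          (-1) ^ a.1 * e x a.1 * ∑ i, x i ^ a.2 := by
      refine Finset.sum_congr rfl fun a ha => ?_
      rw [mem_erase, mem_filter, HasAntidiagonal.mem_antidiagonal] at ha
      have : a.1 ≠ 0 := by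
        intro h0
        exact ha.1 (Prod.ext h0 (by simp; omega))
      rw [elt a.1 ha.2.2, hlt a.2 (by omega)]
    rw [h2]
    ring
  have vieta : ∀ z : σ → ℂ, ∏ i, (X - C (z i)) =
      ∑ k ∈ range (q + 1), (-1) ^ k * (C (e z k) * X ^ (q - k)) := by
    intro z
    have := Multiset.prod_X_sub_X_eq_sum_esymm (univ.val.map z)
    rw [Multiset.map_map, Multiset.card_map, card_val] at this
    simp only [e, MvPolynomial.aeval_esymm_eq_multiset_esymm]
    exact this
  rw [vieta, vieta, sum_range_succ, sum_range_succ, eeq]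
  rw [Finset.sum_congr rfl fun k hk => by rw [elt k (mem_range.1 hk)]]
  have hs : ((-1 : ℂ[X]) ^ q) * (-1) ^ (q + 1) = -1 := by
    rw [← pow_add]; exact Odd.neg_one_pow ⟨q, by ring⟩
  simp only [map_add, map_mul, map_pow, map_neg, map_one, Nat.sub_self, pow_zero, mul_one]
  linear_combination C δ * hs

theorem trace_pow_eq_sum_eigenvalues [DecidableEq σ] {A : Matrix σ σ ℂ} (hA : A.IsHermitian)
    (k : ℕ) : (A ^ k).trace = ∑ i, (hA.eigenvalues i : ℂ) ^ k := by
  conv_lhs => rw [hA.spectral_theorem, ← map_pow, Unitary.conjStarAlgAut_apply, trace_mul_cycle,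
    Unitary.coe_star_mul_self, one_mul, diagonal_pow, trace_diagonal]
  rfl

theorem charpoly_of_trace_pow [DecidableEq σ] {A B : Matrix σ σ ℂ} (hA : A.IsHermitian)
    (hB : B.IsHermitian) (δ : ℂ) (hσ : 0 < Fintype.card σ)
    (hlt : ∀ k, k < Fintype.card σ → (A ^ k).trace = (B ^ k).trace)
    (heq : (B ^ Fintype.card σ).trace = (A ^ Fintype.card σ).trace + Fintype.card σ * δ) :
    B.charpoly = A.charpoly - C δ := by
  rw [hA.charpoly_eq, hB.charpoly_eq]
  refine prod_X_sub_C_of_power_sums _ _ δ hσ (fun k hk => ?_) ?_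
  · have := hlt k hk
    rwa [trace_pow_eq_sum_eigenvalues hA, trace_pow_eq_sum_eigenvalues hB] at this
  · rwa [trace_pow_eq_sum_eigenvalues hA, trace_pow_eq_sum_eigenvalues hB] at heq

end Newton

end Harper

namespace Harper

/-! ### Weyl pairs and Chambers' relation. -/

section WeylPair

open Matrix hiding inv_zpow' zpow_one_add zpow_neg_one zpow_neg zpow_add_one zpow_add

/-- Unimodular scalar matrices, as a homomorphism to the unitary group. -/
def scalarUnitary (n : Type*) [Fintype n] [DecidableEq n] : Circle →* unitaryGroup n ℂ where
  toFun z := ⟨(z : ℂ) • 1, by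
    rw [mem_unitaryGroup_iff, star_smul, star_one, smul_mul_smul_comm, one_mul]
    change ((z : ℂ) * (starRingEnd ℂ) (z : ℂ)) • (1 : Matrix n n ℂ) = 1
    rw [← Circle.coe_inv_eq_conj, ← Circle.coe_mul, mul_inv_cancel, Circle.coe_one, one_smul]⟩
  map_one' := Subtype.ext (by simp)
  map_mul' x y := Subtype.ext (by simp [smul_smul, mul_comm])

/-- The action of `u + u⁻¹ + v + v⁻¹` on the coefficients of the ordered monomials `v ^ b * u ^ a`,
where `u * v = ω • (v * u)`. -/
def weylStep (ω : Circle) : (ℤ × ℤ →₀ ℂ) →ₗ[ℂ] (ℤ × ℤ →₀ ℂ) :=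
  Finsupp.linearCombination ℂ fun p =>
    ((ω ^ p.2 : Circle) : ℂ) • Finsupp.single (p.1 + 1, p.2) (1 : ℂ)
      + ((ω ^ (-p.2) : Circle) : ℂ) • Finsupp.single (p.1 - 1, p.2) (1 : ℂ)
      + Finsupp.single (p.1, p.2 + 1) (1 : ℂ) + Finsupp.single (p.1, p.2 - 1) (1 : ℂ)

/-- The coefficients of `(u + u⁻¹ + v + v⁻¹) ^ k`. -/
def weylCoeff (ω : Circle) (k : ℕ) : ℤ × ℤ →₀ ℂ := (weylStep ω ^ k) (Finsupp.single 0 1)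

theorem weylStep_single (ω : Circle) (a b : ℤ) : weylStep ω (Finsupp.single (a, b) 1) =
    ((ω ^ b : Circle) : ℂ) • Finsupp.single (a + 1, b) (1 : ℂ)
      + ((ω ^ (-b) : Circle) : ℂ) • Finsupp.single (a - 1, b) (1 : ℂ)
      + Finsupp.single (a, b + 1) (1 : ℂ) + Finsupp.single (a, b - 1) (1 : ℂ) := by
  simp [weylStep]

theorem weylCoeff_succ (ω : Circle) (k : ℕ) :
    weylCoeff ω (k + 1) = weylStep ω (weylCoeff ω k) := by
  rw [weylCoeff, pow_succ']; rfl

/-- The span of the monomials with both exponents less than `k` in absolute value. -/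
def weylBox (k : ℕ) : Submodule ℂ (ℤ × ℤ →₀ ℂ) :=
  Submodule.span ℂ {f | ∃ a b : ℤ, |a| < k ∧ |b| < k ∧ f = Finsupp.single (a, b) 1}

theorem single_mem_weylBox {k : ℕ} {a b : ℤ} (ha : |a| < k) (hb : |b| < k) :
    Finsupp.single (a, b) (1 : ℂ) ∈ weylBox k :=
  Submodule.subset_span ⟨a, b, ha, hb, rfl⟩

theorem weylStep_mem (ω : Circle) {k : ℕ} {f : ℤ × ℤ →₀ ℂ} (hf : f ∈ weylBox k) :
    weylStep ω f ∈ weylBox (k + 1) := by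
  refine Submodule.span_induction (p := fun g _ => weylStep ω g ∈ weylBox (k + 1))
    ?_ ?_ ?_ ?_ hf
  · rintro _ ⟨a, b, ha, hb, rfl⟩
    rw [abs_lt] at ha hb
    rw [weylStep_single]
    refine add_mem (add_mem (add_mem (Submodule.smul_mem _ _ ?_) (Submodule.smul_mem _ _ ?_)) ?_) ?_
    all_goals
      refine single_mem_weylBox ?_ ?_ <;> rw [abs_lt] <;> push_cast <;> constructor <;> linarith
  · simp
  · intro x y _ _ hx hy
    rw [map_add]; exact add_mem hx hy
  · intro c x _ hx
    rw [map_smul]; exact Submodule.smul_mem _ _ hx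

/-- The four extreme monomials of degree `k`. -/
def weylTop (k : ℕ) : ℤ × ℤ →₀ ℂ :=
  Finsupp.single ((k : ℤ), 0) 1 + Finsupp.single (-(k : ℤ), 0) 1
    + Finsupp.single (0, (k : ℤ)) 1 + Finsupp.single (0, -(k : ℤ)) 1

/-- An exponent of absolute value equal to the degree forces every factor to be the same letter, so
u^{±(k+1)} and v^{±(k+1)} occur once each and without a power of ω. -/
theorem weylCoeff_sub_top_mem (ω : Circle) (k : ℕ) :
    weylCoeff ω (k + 1) - weylTop (k + 1) ∈ weylBox (k + 1) := by
  induction k with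
  | zero =>
    have h0 : (Finsupp.single 0 1 : ℤ × ℤ →₀ ℂ) = Finsupp.single ((0 : ℤ), (0 : ℤ)) 1 := rfl
    have : weylCoeff ω (0 + 1) - weylTop (0 + 1) = 0 := by
      rw [weylCoeff_succ, weylCoeff, pow_zero, Module.End.one_apply, h0, weylStep_single, weylTop]
      simp
    rw [this]
    exact zero_mem _
  | succ k ih =>
    have h1 := weylStep_mem ω ih
    rw [map_sub, ← weylCoeff_succ] at h1
    -- Four extreme monomials yield sixteen terms; four are the new extremes and the other twelve,
    -- listed in `hsum`, lie in the box.
    have h2 : weylStep ω (weylTop (k + 1)) - weylTop (k + 1 + 1) ∈ weylBox (k + 1 + 1) := by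
      have hk : (0 : ℤ) ≤ k := Int.natCast_nonneg k
      have hc : ∀ z : Circle, ∀ a b : ℤ, |a| < k + 2 → |b| < k + 2 →
          (z : ℂ) • Finsupp.single (a, b) (1 : ℂ) ∈ weylBox (k + 1 + 1) := by
        intro z a b ha hb
        refine Submodule.smul_mem _ _ (single_mem_weylBox ?_ ?_) <;> push_cast <;> linarith
      have hd : ∀ a b : ℤ, |a| < k + 2 → |b| < k + 2 →
          Finsupp.single (a, b) (1 : ℂ) ∈ weylBox (k + 1 + 1) := by
        intro a b ha hb
        refine single_mem_weylBox ?_ ?_ <;> push_cast <;> linarith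
      have hsum := add_mem (add_mem (add_mem (add_mem (add_mem (add_mem (add_mem (add_mem (add_mem
        (add_mem (add_mem
        (hd k 0 ?_ ?_) (hd (k + 1) 1 ?_ ?_)) (hd (k + 1) (-1) ?_ ?_))
        (hd (-k) 0 ?_ ?_)) (hd (-(k + 1)) 1 ?_ ?_)) (hd (-(k + 1)) (-1) ?_ ?_))
        (hc (ω ^ ((k : ℤ) + 1)) 1 (k + 1) ?_ ?_)) (hc (ω ^ (-((k : ℤ) + 1))) (-1) (k + 1) ?_ ?_))
        (hd 0 k ?_ ?_))
        (hc (ω ^ (-((k : ℤ) + 1))) 1 (-(k + 1)) ?_ ?_)) (hc (ω ^ ((k : ℤ) + 1)) (-1) (-(k + 1)) ?_ ?_))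
        (hd 0 (-k) ?_ ?_)
      · convert hsum using 1
        simp only [weylTop, map_add, weylStep_single]
        have e1 : (k : ℤ) + 1 - 1 = k := by ring
        have e2 : -((k : ℤ) + 1) + 1 = -k := by ring
        have e3 : -((k : ℤ) + 1 + 1) = -((k : ℤ) + 1) - 1 := by ring
        push_cast
        simp only [e1, e2, e3, zpow_zero, neg_zero, one_smul, neg_neg]
        abel
      all_goals rw [abs_lt]; constructor <;> linarith
    have := add_mem h1 h2
    rwa [sub_add_sub_cancel] at this

theorem weylCoeff_mem (ω : Circle) (k : ℕ) : weylCoeff ω k ∈ weylBox (k + 1) := by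
  induction k with
  | zero =>
    rw [weylCoeff, pow_zero, Module.End.one_apply]
    exact single_mem_weylBox (a := 0) (b := 0) (by simp) (by simp)
  | succ k ih =>
    rw [weylCoeff_succ]
    exact weylStep_mem ω ih

theorem weylBox_mono {k l : ℕ} (h : k ≤ l) : weylBox k ≤ weylBox l := by
  refine Submodule.span_mono ?_
  rintro _ ⟨a, b, ha, hb, rfl⟩
  have : (k : ℤ) ≤ l := by exact_mod_cast h
  exact ⟨a, b, by linarith, by linarith, rfl⟩

variable {n : Type*} [Fintype n] [DecidableEq n]

theorem scalarUnitary_commute (z : Circle) (w : unitaryGroup n ℂ) :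
    Commute (scalarUnitary n z) w :=
  Subtype.ext (by simp [scalarUnitary])

/-- The evaluation of coefficients at a pair of unitary matrices. -/
def weylEval (u v : unitaryGroup n ℂ) : (ℤ × ℤ →₀ ℂ) →ₗ[ℂ] Matrix n n ℂ :=
  Finsupp.linearCombination ℂ fun p => ((v ^ p.2 * u ^ p.1 : unitaryGroup n ℂ) : Matrix n n ℂ)

theorem weylEval_single (u v : unitaryGroup n ℂ) (a b : ℤ) :
    weylEval u v (Finsupp.single (a, b) 1) =
      ((v ^ b * u ^ a : unitaryGroup n ℂ) : Matrix n n ℂ) := by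
  simp [weylEval]

/-- The sum `u + u⁻¹ + v + v⁻¹` for unitary matrices. -/
def weylSum (u v : unitaryGroup n ℂ) : Matrix n n ℂ :=
  (u : Matrix n n ℂ) + ((u⁻¹ : unitaryGroup n ℂ) : Matrix n n ℂ)
    + (v : Matrix n n ℂ) + ((v⁻¹ : unitaryGroup n ℂ) : Matrix n n ℂ)

theorem weylSum_isHermitian (u v : unitaryGroup n ℂ) : (weylSum u v).IsHermitian := by
  simp only [weylSum, IsHermitian, UnitaryGroup.inv_val, conjTranspose_add, star_eq_conjTranspose,
    conjTranspose_conjTranspose]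
  abel

section Pair

variable {ω : Circle} {u v : unitaryGroup n ℂ}

theorem weyl_mul_zpow
    (h : u * v = scalarUnitary n ω * (v * u)) (b : ℤ) :
    u * v ^ b = scalarUnitary n (ω ^ b) * (v ^ b * u) := by
  have h1 : SemiconjBy u v (scalarUnitary n ω * v) := by
    rw [SemiconjBy, h, mul_assoc]
  have h2 := h1.zpow_right b
  rw [(scalarUnitary_commute ω v).mul_zpow, ← map_zpow] at h2
  rw [h2.eq, mul_assoc]

theorem weyl_zpow_mul
    (h : u * v = scalarUnitary n ω * (v * u)) (a : ℤ) :
    v * u ^ a = scalarUnitary n (ω ^ (-a)) * (u ^ a * v) := by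
  have h1 : SemiconjBy v u (scalarUnitary n ω⁻¹ * u) := by
    rw [SemiconjBy, mul_assoc, h, ← mul_assoc, ← map_mul, inv_mul_cancel, map_one, one_mul]
  have h2 := h1.zpow_right a
  rw [(scalarUnitary_commute ω⁻¹ u).mul_zpow, ← map_zpow, inv_zpow'] at h2
  rw [h2.eq, mul_assoc]

theorem coe_scalarUnitary_mul (z : Circle) (w : unitaryGroup n ℂ) :
    ((scalarUnitary n z * w : unitaryGroup n ℂ) : Matrix n n ℂ) = (z : ℂ) • (w : Matrix n n ℂ) := by
  simp [scalarUnitary]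

theorem weylEval_weylStep
    (h : u * v = scalarUnitary n ω * (v * u)) (f : ℤ × ℤ →₀ ℂ) :
    weylEval u v (weylStep ω f) = weylSum u v * weylEval u v f := by
  have : weylEval u v ∘ₗ weylStep ω = LinearMap.mulLeft ℂ (weylSum u v) ∘ₗ weylEval u v := by
    refine Finsupp.lhom_ext' fun ⟨a, b⟩ => LinearMap.ext_ring ?_
    simp only [LinearMap.comp_apply, Finsupp.lsingle_apply, weylStep_single, map_add, map_smul,
      weylEval_single, LinearMap.mulLeft_apply, weylSum, add_mul, ← UnitaryGroup.mul_val]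
    rw [← coe_scalarUnitary_mul, ← coe_scalarUnitary_mul]
    congr 1
    · congr 1
      · congr 1
        · congr 1
          rw [← mul_assoc u, weyl_mul_zpow h, mul_assoc, mul_assoc, ← zpow_one_add, add_comm 1 a]
        · congr 1
          rw [eq_inv_mul_iff_mul_eq, ← mul_assoc u, ← (scalarUnitary_commute _ u).eq, mul_assoc,
            ← mul_assoc u, weyl_mul_zpow h, ← mul_assoc, ← mul_assoc, ← map_mul, ← zpow_add,
            neg_add_cancel, zpow_zero, map_one, one_mul, mul_assoc, ← zpow_one_add,
            add_sub_cancel]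
      · rw [← mul_assoc, ← zpow_one_add, add_comm 1 b]
    · rw [← mul_assoc, ← zpow_neg_one, ← zpow_add, neg_add_eq_sub]
  exact LinearMap.congr_fun this f

/-- The coefficients depend on ω alone, so traces for two Weyl pairs can be compared without
computing them. -/
theorem weylEval_weylCoeff
    (h : u * v = scalarUnitary n ω * (v * u)) (k : ℕ) :
    weylEval u v (weylCoeff ω k) = weylSum u v ^ k := by
  induction k with
  | zero =>
    rw [weylCoeff, pow_zero, Module.End.one_apply, pow_zero]
    exact (weylEval_single u v 0 0).trans (by simp)
  | succ k ih => rw [weylCoeff_succ, weylEval_weylStep h, ih, pow_succ']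

theorem trace_conj_unitary (w m : unitaryGroup n ℂ) :
    ((w * m * w⁻¹ : unitaryGroup n ℂ) : Matrix n n ℂ).trace = (m : Matrix n n ℂ).trace := by
  rw [UnitaryGroup.mul_val, trace_mul_comm, ← UnitaryGroup.mul_val, inv_mul_cancel_left]

/-- Conjugation by u multiplies the monomial by ω^b and conjugation by v by ω^{-a}, while the trace
is unchanged. One of these factors differs from 1. -/
theorem trace_monomial_eq_zero
    (h : u * v = scalarUnitary n ω * (v * u)) {q : ℕ} (hω : IsPrimitiveRoot ω q) {a b : ℤ}
    (ha : |a| < q) (hb : |b| < q) (hab : (a, b) ≠ 0) :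
    ((v ^ b * u ^ a : unitaryGroup n ℂ) : Matrix n n ℂ).trace = 0 := by
  have key : ∀ (c : ℤ) (w : unitaryGroup n ℂ), |c| < q → c ≠ 0 →
      w * (v ^ b * u ^ a) = scalarUnitary n (ω ^ c) * (v ^ b * u ^ a * w) →
      ((v ^ b * u ^ a : unitaryGroup n ℂ) : Matrix n n ℂ).trace = 0 := by
    intro c w hc hc0 hw
    have h1 := trace_conj_unitary w (v ^ b * u ^ a)
    rw [hw, mul_assoc, mul_inv_cancel_right, coe_scalarUnitary_mul, trace_smul, smul_eq_mul] at h1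
    by_contra ht
    have h2 : ((ω ^ c : Circle) : ℂ) = 1 := mul_right_cancel₀ ht (by rw [h1, one_mul])
    have h3 : ω ^ c = 1 := Circle.ext (by rw [h2, Circle.coe_one])
    rw [hω.zpow_eq_one_iff_dvd] at h3
    exact hc0 (Int.eq_zero_of_abs_lt_dvd h3 hc)
  by_cases ha0 : a = 0
  · have hb0 : b ≠ 0 := fun hb0 => hab (by rw [ha0, hb0]; rfl)
    refine key b u hb hb0 ?_
    rw [← mul_assoc, weyl_mul_zpow h]
    simp only [mul_assoc]
    rw [← zpow_one_add, ← zpow_add_one, add_comm]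
  · refine key (-a) v (by rwa [abs_neg]) (neg_ne_zero.2 ha0) ?_
    rw [← mul_assoc v, ← zpow_one_add, add_comm 1 b, zpow_add_one, mul_assoc, weyl_zpow_mul h,
      ← mul_assoc, ← (scalarUnitary_commute _ (v ^ b)).eq]
    simp only [mul_assoc]

theorem trace_weylEval_of_mem
    (h : u * v = scalarUnitary n ω * (v * u)) {q : ℕ} (hω : IsPrimitiveRoot ω q)
    {f : ℤ × ℤ →₀ ℂ} (hf : f ∈ weylBox q) :
    (weylEval u v f).trace = Fintype.card n * f 0 := by
  refine Submodule.span_induction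
    (p := fun g _ => (weylEval u v g).trace = Fintype.card n * g 0) ?_ ?_ ?_ ?_ hf
  · rintro _ ⟨a, b, ha, hb, rfl⟩
    rw [weylEval_single]
    by_cases hab : (a, b) = 0
    · obtain ⟨rfl, rfl⟩ := Prod.mk.inj hab
      rw [hab]
      simp
    · rw [trace_monomial_eq_zero h hω ha hb hab, Finsupp.single_eq_of_ne (Ne.symm hab), mul_zero]
  · simp
  · intro x y _ _ hx hy
    rw [map_add, trace_add, hx, hy, Finsupp.add_apply, mul_add]
  · intro c x _ hx
    rw [map_smul, trace_smul, hx, Finsupp.smul_apply, smul_eq_mul, smul_eq_mul]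
    ring

theorem trace_weylSum_pow_of_lt
    (h : u * v = scalarUnitary n ω * (v * u)) {q k : ℕ} (hω : IsPrimitiveRoot ω q) (hk : k < q) :
    (weylSum u v ^ k).trace = Fintype.card n * weylCoeff ω k 0 := by
  rw [← weylEval_weylCoeff h]
  exact trace_weylEval_of_mem h hω (weylBox_mono hk (weylCoeff_mem ω k))

/-- In degree q the only monomials outside the box are u^{±q} and v^{±q}, which are scalar. -/
theorem trace_weylSum_pow
    (h : u * v = scalarUnitary n ω * (v * u)) {q : ℕ} (hq : 0 < q) (hω : IsPrimitiveRoot ω q)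
    {X Y : Circle} (hu : u ^ q = scalarUnitary n X) (hv : v ^ q = scalarUnitary n Y) :
    (weylSum u v ^ q).trace =
      Fintype.card n * (weylCoeff ω q 0 + (X + (X : ℂ)⁻¹ + Y + (Y : ℂ)⁻¹)) := by
  obtain ⟨k, rfl⟩ : ∃ k, q = k + 1 := ⟨q - 1, by omega⟩
  have h1 := trace_weylEval_of_mem h hω (weylCoeff_sub_top_mem ω k)
  have hs : ∀ z : Circle, (scalarUnitary n z : Matrix n n ℂ).trace = Fintype.card n * (z : ℂ) := by
    intro z
    simp [scalarUnitary, mul_comm]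
  have h2 : (weylEval u v (weylTop (k + 1))).trace =
      Fintype.card n * (X + (X : ℂ)⁻¹ + Y + (Y : ℂ)⁻¹) := by
    simp only [weylTop, map_add, weylEval_single, trace_add, zpow_neg, zpow_natCast, hu, hv,
      zpow_zero, one_mul, mul_one, ← map_inv, hs, Circle.coe_inv]
    ring
  have h3 : weylTop (k + 1) 0 = 0 := by
    have : (k : ℤ) + 1 ≠ 0 := by omega
    have h' : -1 + -(k : ℤ) ≠ 0 := by omega
    simp [weylTop, Prod.ext_iff, this, h']
  rw [map_sub, trace_sub, weylEval_weylCoeff h, h2, Finsupp.sub_apply, h3, sub_zero] at h1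
  linear_combination h1

end Pair

open Polynomial in
/-- The characteristic polynomial of `u + u⁻¹ + v + v⁻¹` for a Weyl pair of order `q` depends on
the pair only through the constant term. -/
theorem charpoly_weylSum {ω : Circle} {u v u' v' : unitaryGroup n ℂ} (hn : 0 < Fintype.card n)
    (hω : IsPrimitiveRoot ω (Fintype.card n))
    (h : u * v = scalarUnitary n ω * (v * u)) (h' : u' * v' = scalarUnitary n ω * (v' * u'))
    {X Y X' Y' : Circle}
    (hu : u ^ Fintype.card n = scalarUnitary n X) (hv : v ^ Fintype.card n = scalarUnitary n Y)
    (hu' : u' ^ Fintype.card n = scalarUnitary n X')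
    (hv' : v' ^ Fintype.card n = scalarUnitary n Y') :
    (weylSum u' v').charpoly = (weylSum u v).charpoly -
      C ((X' + (X' : ℂ)⁻¹ + Y' + (Y' : ℂ)⁻¹) - (X + (X : ℂ)⁻¹ + Y + (Y : ℂ)⁻¹)) := by
  refine charpoly_of_trace_pow (weylSum_isHermitian u v) (weylSum_isHermitian u' v') _ hn
    (fun k hk => ?_) ?_
  · rw [trace_weylSum_pow_of_lt h hω hk, trace_weylSum_pow_of_lt h' hω hk]
  · rw [trace_weylSum_pow h hn hω hu hv, trace_weylSum_pow h' hn hω hu' hv']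
    ring

end WeylPair

end Harper

namespace Harper

/-! ### Cyclic matrices: the Floquet representation and the chiral gauge. -/

section Representations

open Matrix (unitaryGroup)

variable {q : ℕ} [NeZero q]

/-- The weighted cyclic shift `x ↦ (i ↦ g i * x (i + 1))`. -/
def weightedShift (g : ZMod q → Circle) : unitaryGroup (ZMod q) ℂ :=
  ⟨Matrix.of fun i j => if j = i + 1 then (g i : ℂ) else 0, by
    rw [Matrix.mem_unitaryGroup_iff]
    ext i j
    rw [Matrix.mul_apply, Finset.sum_eq_single (i + 1)]
    · rcases eq_or_ne i j with rfl | hij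
      · simp only [Matrix.of_apply, if_true, Matrix.star_apply, Matrix.one_apply_eq]
        change (g i : ℂ) * (starRingEnd ℂ) (g i : ℂ) = 1
        rw [← Circle.coe_inv_eq_conj, ← Circle.coe_mul, mul_inv_cancel, Circle.coe_one]
      · simp [Matrix.one_apply_ne hij, hij]
    · intro b _ hb
      simp [hb]
    · simp⟩

/-- The diagonal unitary matrix with entries `d i`. -/
def diagonalUnitary (d : ZMod q → Circle) : unitaryGroup (ZMod q) ℂ :=
  ⟨Matrix.diagonal fun i => (d i : ℂ), by
    rw [Matrix.mem_unitaryGroup_iff, Matrix.star_eq_conjTranspose, Matrix.diagonal_conjTranspose,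
      Matrix.diagonal_mul_diagonal, ← Matrix.diagonal_one]
    congr 1
    funext i
    change (d i : ℂ) * (starRingEnd ℂ) (d i : ℂ) = 1
    rw [← Circle.coe_inv_eq_conj, ← Circle.coe_mul, mul_inv_cancel, Circle.coe_one]⟩

theorem weightedShift_apply (g : ZMod q → Circle) (i j : ZMod q) :
    (weightedShift g : Matrix (ZMod q) (ZMod q) ℂ) i j = if j = i + 1 then (g i : ℂ) else 0 := rfl

theorem weightedShift_mulVec (g : ZMod q → Circle) (x : ZMod q → ℂ) (i : ZMod q) :
    Matrix.mulVec (weightedShift g : Matrix (ZMod q) (ZMod q) ℂ) x i = g i * x (i + 1) := by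
  simp [Matrix.mulVec, dotProduct, weightedShift_apply]

theorem weightedShift_pow_apply (g : ZMod q → Circle) (k : ℕ) (i j : ZMod q) :
    ((weightedShift g : Matrix (ZMod q) (ZMod q) ℂ) ^ k) i j =
      if j = i + k then ∏ l ∈ Finset.range k, (g (i + l) : ℂ) else 0 := by
  induction k generalizing j with
  | zero => simp [Matrix.one_apply, eq_comm]
  | succ k ih =>
    rw [pow_succ, Matrix.mul_apply]
    simp only [ih, weightedShift_apply, Finset.prod_range_succ]
    rw [Finset.sum_eq_single (i + k)]
    · simp [add_assoc]
    · intro b _ hb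
      simp [hb]
    · simp

theorem prod_range_natCast {M : Type*} [CommMonoid M] (f : ZMod q → M) :
    ∏ l ∈ Finset.range q, f (l : ZMod q) = ∏ j, f j := by
  refine Finset.prod_bij' (fun l _ => (l : ZMod q)) (fun j _ => j.val) ?_ ?_ ?_ ?_ ?_
  · simp
  · intro j _
    exact Finset.mem_range.2 (ZMod.val_lt j)
  · intro l hl
    exact ZMod.val_cast_of_lt (Finset.mem_range.1 hl)
  · simp
  · simp

theorem coe_prod_circle {ι : Type*} (t : Finset ι) (f : ι → Circle) :
    ((∏ i ∈ t, f i : Circle) : ℂ) = ∏ i ∈ t, (f i : ℂ) :=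
  map_prod Circle.coeHom f t

theorem coe_exp_add_inv (t : ℝ) :
    (Circle.exp t : ℂ) + (Circle.exp t : ℂ)⁻¹ = ((2 * Real.cos t : ℝ) : ℂ) := by
  rw [← Circle.coe_inv, ← Circle.exp_neg, Circle.coe_exp, Circle.coe_exp]
  push_cast
  rw [Complex.two_cos]

theorem weightedShift_pow (g : ZMod q → Circle) :
    weightedShift g ^ q = scalarUnitary (ZMod q) (∏ i, g i) := by
  refine Subtype.ext ?_
  ext i j
  rw [SubmonoidClass.coe_pow, weightedShift_pow_apply]
  have h1 : ∏ l ∈ Finset.range q, (g (i + l) : ℂ) = ((∏ j, g j : Circle) : ℂ) := by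
    rw [prod_range_natCast fun l => (g (i + l) : ℂ), coe_prod_circle]
    exact Fintype.prod_equiv (Equiv.addLeft i) _ _ fun _ => rfl
  rw [h1]
  simp [scalarUnitary, Matrix.one_apply, eq_comm]

theorem diagonalUnitary_pow (d : ZMod q → Circle) (k : ℕ) (Y : Circle) (h : ∀ i, d i ^ k = Y) :
    diagonalUnitary d ^ k = scalarUnitary (ZMod q) Y := by
  refine Subtype.ext ?_
  rw [SubmonoidClass.coe_pow]
  change Matrix.diagonal (fun i => (d i : ℂ)) ^ k = (Y : ℂ) • 1
  rw [Matrix.diagonal_pow, Matrix.smul_one_eq_diagonal]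
  congr 1
  funext i
  rw [Pi.pow_apply, ← Circle.coe_pow, h]

theorem weightedShift_mul_diagonalUnitary (g d : ZMod q → Circle) (ω : Circle)
    (h : ∀ i, d (i + 1) = ω * d i) :
    weightedShift g * diagonalUnitary d =
      scalarUnitary (ZMod q) ω * (diagonalUnitary d * weightedShift g) := by
  refine Subtype.ext ?_
  rw [coe_scalarUnitary_mul]
  ext i j
  change ((weightedShift g : Matrix (ZMod q) (ZMod q) ℂ) * Matrix.diagonal fun i => (d i : ℂ)) i j =
    (ω : ℂ) * ((Matrix.diagonal fun i => (d i : ℂ)) *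
      (weightedShift g : Matrix (ZMod q) (ZMod q) ℂ)) i j
  rw [Matrix.mul_diagonal, Matrix.diagonal_mul, weightedShift_apply]
  split_ifs with hj
  · rw [hj, h, Circle.coe_mul]; ring
  · simp

/-- The second shift is diag(w) times the first, and moving diag(w) past a shift costs the factor ω.
-/
theorem weightedShift_mul_weightedShift (g w : ZMod q → Circle) (ω : Circle)
    (h : ∀ i, w (i + 1) = ω * w i) :
    weightedShift g * weightedShift (w * g) =
      scalarUnitary (ZMod q) ω * (weightedShift (w * g) * weightedShift g) := by
  refine Subtype.ext ?_
  rw [coe_scalarUnitary_mul]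
  ext i j
  have key : ∀ a b : ZMod q → Circle, ((weightedShift a * weightedShift b :
      unitaryGroup (ZMod q) ℂ) : Matrix (ZMod q) (ZMod q) ℂ) i j =
      if j = i + 1 + 1 then (a i : ℂ) * b (i + 1) else 0 := by
    intro a b
    rw [Matrix.UnitaryGroup.mul_val, Matrix.mul_apply, Finset.sum_eq_single (i + 1)]
    · simp [weightedShift_apply]
    · intro b _ hb
      simp [weightedShift_apply, hb]
    · simp
  rw [Matrix.smul_apply, key, key, smul_eq_mul]
  split_ifs with hj
  · rw [Pi.mul_apply, Pi.mul_apply, h]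
    simp only [Circle.coe_mul]
    ring
  · simp

/-- The character `i ↦ exp (2πi p i / q)` of `ℤ/q`. -/
def phase (p q : ℕ) [NeZero q] (i : ZMod q) : Circle := ZMod.toCircle ((p : ZMod q) * i)

theorem phase_add_one (p : ℕ) (i : ZMod q) : phase p q (i + 1) = phase p q 1 * phase p q i := by
  rw [phase, mul_add, AddChar.map_add_eq_mul, mul_comm]
  rfl

theorem phase_zero (p : ℕ) : phase p q 0 = 1 := by
  rw [phase, mul_zero, AddChar.map_zero_eq_one]

theorem phase_intCast (p : ℕ) (m : ℤ) :
    phase p q (m : ZMod q) = Circle.exp (2 * Real.pi * (p / q * m)) := by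
  have : ((p : ZMod q) * (m : ZMod q)) = ((p * m : ℤ) : ZMod q) := by push_cast; rfl
  rw [phase, this]
  ext
  rw [ZMod.toCircle_intCast, Circle.coe_exp]
  congr 1
  push_cast
  ring

theorem phase_pow (p : ℕ) (i : ZMod q) : phase p q i ^ q = 1 := by
  rw [phase, ← AddChar.map_nsmul_eq_pow, nsmul_eq_mul, CharP.cast_eq_zero, zero_mul,
    AddChar.map_zero_eq_one]

theorem isPrimitiveRoot_phase {p : ℕ} (hpq : p.Coprime q) : IsPrimitiveRoot (phase p q 1) q := by
  refine IsPrimitiveRoot.of_map_of_injective (f := Circle.coeHom) ?_ Circle.coe_injective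
  have h := Complex.isPrimitiveRoot_exp_of_coprime p q (NeZero.ne q) hpq
  convert h using 1
  have := phase_intCast (q := q) p 1
  rw [Int.cast_one] at this
  rw [this]
  change ((Circle.exp _ : Circle) : ℂ) = _
  rw [Circle.coe_exp]
  congr 1
  push_cast
  ring

theorem phase_injective {p : ℕ} (hpq : p.Coprime q) : Function.Injective (phase p q) := by
  intro i j hij
  have h := ZMod.injective_toCircle hij
  exact (ZMod.isUnit_iff_coprime p q).2 hpq |>.mul_left_cancel h

/-- The phases run through all q-th roots of unity, so this is X^q - 1 evaluated at 0. -/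
theorem prod_neg_phase {p : ℕ} (hpq : p.Coprime q) : ∏ i : ZMod q, -(phase p q i : ℂ) = -1 := by
  classical
  have hω : IsPrimitiveRoot ((phase p q 1 : Circle) : ℂ) q :=
    (isPrimitiveRoot_phase hpq).map_of_injective (f := Circle.coeHom) Circle.coe_injective
  have h := hω.pow_sub_pow_eq_prod_sub_mul 0 1 (NeZero.pos q)
  rw [zero_pow (NeZero.ne q), one_pow, zero_sub] at h
  have himg : Finset.univ.image (fun i : ZMod q => (phase p q i : ℂ)) =
      Polynomial.nthRootsFinset q (1 : ℂ) := by
    refine Finset.eq_of_subset_of_card_le ?_ ?_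
    · intro z hz
      obtain ⟨i, -, rfl⟩ := Finset.mem_image.1 hz
      rw [Polynomial.mem_nthRootsFinset (NeZero.pos q), ← Circle.coe_pow, phase_pow, Circle.coe_one]
    · rw [hω.card_nthRootsFinset, Finset.card_image_of_injective _
        (fun i j hij => phase_injective hpq (Circle.coe_injective hij)), Finset.card_univ, ZMod.card]
  rw [h, ← himg, Finset.prod_image fun i _ j _ hij =>
    phase_injective hpq (Circle.coe_injective hij)]
  simp

/-- The corner weights: `κ` at `0` and `1` elsewhere. -/
def corner (κ : Circle) (i : ZMod q) : Circle := if i = 0 then κ else 1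

/-- The diagonal of `v * u⁻¹` in the chiral gauge, chosen so that `-1` lies halfway between two
of its neighbouring entries. -/
def chiralPhase (p q : ℕ) [NeZero q] (i : ZMod q) : Circle :=
  Circle.exp (Real.pi + Real.pi / q) * phase p q i

theorem coe_chiralPhase (p : ℕ) (i : ZMod q) :
    (chiralPhase p q i : ℂ) = Complex.exp (Complex.I * (Real.pi / q : ℝ)) * -(phase p q i : ℂ) := by
  rw [chiralPhase, Circle.coe_mul, Circle.coe_exp]
  push_cast
  rw [add_mul, Complex.exp_add, Complex.exp_pi_mul_I, mul_comm Complex.I]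
  ring

/-- The q factors e^{iπ/q} contribute -1, cancelling the -1 of `prod_neg_phase`. This gives u and v
the same q-th power κ, so that κ = ±1 reaches the extreme values ±4 of the constant term. -/
theorem prod_chiralPhase {p : ℕ} (hpq : p.Coprime q) : ∏ i, chiralPhase p q i = 1 := by
  ext
  rw [coe_prod_circle]
  simp only [coe_chiralPhase]
  rw [Finset.prod_mul_distrib, prod_neg_phase hpq, Finset.prod_const, Finset.card_univ, ZMod.card,
    ← Complex.exp_nat_mul]
  have hq : (q : ℂ) ≠ 0 := NeZero.ne _
  have : (q : ℂ) * (Complex.I * (Real.pi / q : ℝ)) = Real.pi * Complex.I := by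
    push_cast
    field_simp
  rw [this, Complex.exp_pi_mul_I]
  simp

theorem prod_corner (κ : Circle) : ∏ i : ZMod q, corner κ i = κ := by
  simp [corner]

theorem chiral_pow (κ : Circle) : weightedShift (corner (q := q) κ) ^ q =
    scalarUnitary (ZMod q) κ := by
  rw [weightedShift_pow, prod_corner]

theorem chiral_pow' {p : ℕ} (hpq : p.Coprime q) (κ : Circle) :
    weightedShift (chiralPhase p q * corner κ) ^ q = scalarUnitary (ZMod q) κ := by
  rw [weightedShift_pow]
  simp only [Pi.mul_apply]
  rw [Finset.prod_mul_distrib, prod_chiralPhase hpq, prod_corner, one_mul]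

/-- The Harper matrix in the chiral gauge with Floquet factor `κ`. -/
def chiral (p q : ℕ) [NeZero q] (κ : Circle) : Matrix (ZMod q) (ZMod q) ℂ :=
  weylSum (weightedShift (corner κ)) (weightedShift (chiralPhase p q * corner κ))

theorem chiral_commutation (p : ℕ) (κ : Circle) :
    weightedShift (corner κ) * weightedShift (chiralPhase p q * corner κ) =
      scalarUnitary (ZMod q) (phase p q 1) *
        (weightedShift (chiralPhase p q * corner κ) * weightedShift (corner κ)) := by
  refine weightedShift_mul_weightedShift _ _ _ fun i => ?_
  rw [chiralPhase, chiralPhase, phase_add_one, mul_left_comm]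

/-- The Floquet matrix of the Harper operator. -/
def floquet (p q : ℕ) [NeZero q] (θ : ℝ) (μ : Circle) : Matrix (ZMod q) (ZMod q) ℂ :=
  weylSum (weightedShift fun _ => μ)
    (diagonalUnitary fun i => Circle.exp (2 * Real.pi * θ) * phase p q i)

open Polynomial in
-- Chambers' formula. The constant 4 is X + X⁻¹ + Y + Y⁻¹ for the chiral pair with κ = 1.
theorem charpoly_floquet {p : ℕ} (hpq : p.Coprime q) (θ : ℝ) (μ : Circle) :
    (floquet p q θ μ).charpoly = (chiral p q 1).charpoly + C 4 -
      C (((μ ^ q : Circle) : ℂ) + ((μ ^ q : Circle) : ℂ)⁻¹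
        + ((2 * Real.cos (2 * Real.pi * (q * θ)) : ℝ) : ℂ)) := by
  have hY : ∀ i : ZMod q, (Circle.exp (2 * Real.pi * θ) * phase p q i) ^ q =
      Circle.exp (2 * Real.pi * (q * θ)) := by
    intro i
    rw [mul_pow, phase_pow, mul_one]
    ext
    rw [Circle.coe_pow, Circle.coe_exp, Circle.coe_exp, ← Complex.exp_nat_mul]
    congr 1
    push_cast
    ring
  have h := charpoly_weylSum (n := ZMod q) (ω := phase p q 1)
    (u := weightedShift (corner 1)) (v := weightedShift (chiralPhase p q * corner 1))
    (u' := weightedShift fun _ => μ)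
    (v' := diagonalUnitary fun i => Circle.exp (2 * Real.pi * θ) * phase p q i)
    (X := 1) (Y := 1) (X' := μ ^ q) (Y' := Circle.exp (2 * Real.pi * (q * θ)))
    (by rw [ZMod.card]; exact NeZero.pos q) (by rw [ZMod.card]; exact isPrimitiveRoot_phase hpq)
    (chiral_commutation p 1)
    (weightedShift_mul_diagonalUnitary _ _ _ fun i => by rw [phase_add_one, mul_left_comm])
    (by rw [ZMod.card]; exact chiral_pow 1) (by rw [ZMod.card]; exact chiral_pow' hpq 1)
    (by rw [ZMod.card, weightedShift_pow, Finset.prod_const, Finset.card_univ, ZMod.card])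
    (by rw [ZMod.card]; exact diagonalUnitary_pow _ _ _ hY)
  rw [floquet, h, chiral, ← coe_exp_add_inv, sub_eq_add_neg, sub_eq_add_neg (_ + C 4), ← C_neg,
    ← C_neg, add_assoc _ (C 4), ← C_add]
  congr 2
  rw [Circle.coe_one]
  ring

open Polynomial in
theorem charpoly_chiral_neg_one {p : ℕ} (hpq : p.Coprime q) :
    (chiral p q (Circle.exp Real.pi)).charpoly = (chiral p q 1).charpoly + C 8 := by
  have h := charpoly_weylSum (n := ZMod q) (ω := phase p q 1)
    (u := weightedShift (corner 1)) (v := weightedShift (chiralPhase p q * corner 1))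
    (u' := weightedShift (corner (Circle.exp Real.pi)))
    (v' := weightedShift (chiralPhase p q * corner (Circle.exp Real.pi)))
    (X := 1) (Y := 1) (X' := Circle.exp Real.pi) (Y' := Circle.exp Real.pi)
    (by rw [ZMod.card]; exact NeZero.pos q) (by rw [ZMod.card]; exact isPrimitiveRoot_phase hpq)
    (chiral_commutation p 1) (chiral_commutation p _)
    (by rw [ZMod.card]; exact chiral_pow 1) (by rw [ZMod.card]; exact chiral_pow' hpq 1)
    (by rw [ZMod.card]; exact chiral_pow _) (by rw [ZMod.card]; exact chiral_pow' hpq _)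
  rw [chiral, chiral, h, sub_eq_add_neg, ← C_neg]
  congr 2
  rw [Circle.coe_one, Circle.coe_exp, Complex.exp_pi_mul_I]
  norm_num

/-! ### Quadratic forms of the two chiral matrices and their majorant. -/

theorem re_dotProduct_conjTranspose_mulVec {n : Type*} [Fintype n] (M : Matrix n n ℂ) (x : n → ℂ) :
    (star x ⬝ᵥ M.conjTranspose.mulVec x).re = (star x ⬝ᵥ M.mulVec x).re := by
  rw [Matrix.dotProduct_mulVec, Matrix.vecMul_conjTranspose, star_star, Matrix.star_dotProduct,
    Complex.star_def, Complex.conj_re]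

theorem re_dotProduct_weylSum_weightedShift (g g' : ZMod q → Circle) (x : ZMod q → ℂ) :
    (star x ⬝ᵥ (weylSum (weightedShift g) (weightedShift g')).mulVec x).re =
      2 * ∑ i, ((starRingEnd ℂ) (x i) * (((g i : ℂ) + g' i) * x (i + 1))).re := by
  simp only [weylSum, Matrix.UnitaryGroup.inv_val, Matrix.add_mulVec, dotProduct_add,
    Complex.add_re, Matrix.star_eq_conjTranspose, re_dotProduct_conjTranspose_mulVec]
  have h : ∀ g : ZMod q → Circle, (star x ⬝ᵥ Matrix.mulVec
      (weightedShift g : Matrix (ZMod q) (ZMod q) ℂ) x).re =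
      ∑ i, ((starRingEnd ℂ) (x i) * (g i * x (i + 1))).re := by
    intro g
    simp only [dotProduct, weightedShift_mulVec, Complex.re_sum]
    rfl
  rw [h, h, Finset.mul_sum, ← two_mul, add_assoc, ← two_mul, ← mul_add, ← Finset.sum_add_distrib,
    Finset.mul_sum]
  refine Finset.sum_congr rfl fun i _ => ?_
  rw [← Complex.add_re]
  congr 2
  ring

/-- The coupling across the corner in the chiral gauge. -/
def coupling (p q : ℕ) [NeZero q] : ℂ := 1 + chiralPhase p q 0

/-- The coupling is 1 - e^{iπ/q}, and a chord is no longer than its arc. -/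
theorem norm_coupling_le (p : ℕ) : ‖coupling p q‖ ≤ Real.pi / q := by
  have h : coupling p q = -(Complex.exp (Complex.I * (Real.pi / q : ℝ)) - 1) := by
    rw [coupling, coe_chiralPhase, phase_zero, Circle.coe_one]
    ring
  rw [h, norm_neg]
  refine Real.norm_exp_I_mul_ofReal_sub_one_le.trans ?_
  rw [Real.norm_of_nonneg (by positivity)]

theorem re_dotProduct_chiral (p : ℕ) (κ : Circle) (x : ZMod q → ℂ) :
    (star x ⬝ᵥ (chiral p q κ).mulVec x).re =
      2 * (((starRingEnd ℂ) (x 0) * (κ * coupling p q * x 1)).re +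
        ∑ i ∈ Finset.univ.erase 0, ((starRingEnd ℂ) (x i) *
          ((1 + chiralPhase p q i) * x (i + 1))).re) := by
  rw [chiral, re_dotProduct_weylSum_weightedShift, ← Finset.add_sum_erase _ _ (Finset.mem_univ 0)]
  congr 2
  · simp only [Pi.mul_apply, corner, if_true, coupling, zero_add, Circle.coe_mul]
    congr 3
    ring
  · refine Finset.sum_congr rfl fun i hi => ?_
    simp [corner, Finset.ne_of_mem_erase hi]

/-- A common upper bound for the two chiral matrices. -/
def chiralMajorant (p q : ℕ) [NeZero q] : Matrix (ZMod q) (ZMod q) ℂ :=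
  (1 / 2 : ℝ) • (chiral p q 1 + chiral p q (Circle.exp Real.pi)) +
    Matrix.diagonal fun i =>
      ((‖coupling p q‖ * ((if i = 0 then 1 else 0) + if i = 1 then 1 else 0) : ℝ) : ℂ)

theorem chiral_isHermitian (p : ℕ) (κ : Circle) : (chiral p q κ).IsHermitian :=
  weylSum_isHermitian _ _

theorem chiralMajorant_isHermitian (p : ℕ) : (chiralMajorant p q).IsHermitian := by
  refine Matrix.IsHermitian.add ?_ ?_
  · rw [Matrix.IsHermitian, Matrix.conjTranspose_smul, star_trivial,
      ((chiral_isHermitian p 1).add (chiral_isHermitian p _)).eq]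
  · rw [Matrix.isHermitian_diagonal_iff]
    intro i
    exact Complex.conj_ofReal _

theorem trace_chiralMajorant (p : ℕ) :
    (2 * (chiralMajorant p q).trace - (chiral p q 1).trace
      - (chiral p q (Circle.exp Real.pi)).trace).re = 4 * ‖coupling p q‖ := by
  have h : (chiralMajorant p q).trace = (1 / 2) * ((chiral p q 1).trace +
      (chiral p q (Circle.exp Real.pi)).trace) + 2 * ‖coupling p q‖ := by
    rw [chiralMajorant, Matrix.trace_add, Matrix.trace_smul, Matrix.trace_add,
      Matrix.trace_diagonal, ← Complex.ofReal_sum, ← Finset.mul_sum, Finset.sum_add_distrib,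
      Finset.sum_ite_eq', Finset.sum_ite_eq', Complex.real_smul]
    simp only [Finset.mem_univ, if_true]
    push_cast
    ring
  rw [h]
  ring_nf
  simp

/-- Averaging κ = 1 and κ = -1 cancels the corner coupling, leaving the common part plus the
diagonal. Adding the two indicators also covers q = 1, where the indices 0 and 1 coincide. -/
theorem re_dotProduct_chiralMajorant (p : ℕ) (x : ZMod q → ℂ) :
    (star x ⬝ᵥ (chiralMajorant p q).mulVec x).re =
      2 * ∑ i ∈ Finset.univ.erase 0, ((starRingEnd ℂ) (x i) *
          ((1 + chiralPhase p q i) * x (i + 1))).re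
        + ‖coupling p q‖ * (‖x 0‖ ^ 2 + ‖x 1‖ ^ 2) := by
  have hd : (star x ⬝ᵥ (Matrix.diagonal fun i : ZMod q => ((‖coupling p q‖ *
      ((if i = 0 then 1 else 0) + if i = 1 then 1 else 0) : ℝ) : ℂ)).mulVec x).re =
      ‖coupling p q‖ * (‖x 0‖ ^ 2 + ‖x 1‖ ^ 2) := by
    have : ∀ i, (star x i * ((‖coupling p q‖ *
      ((if i = 0 then 1 else 0) + if i = 1 then 1 else 0) : ℝ) * x i)).re = ‖coupling p q‖ *
        ((if i = 0 then ‖x i‖ ^ 2 else 0) + if i = 1 then ‖x i‖ ^ 2 else 0) := by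
      intro i
      rw [Pi.star_apply, Complex.star_def, mul_left_comm, ← Complex.normSq_eq_conj_mul_self,
        Complex.normSq_eq_norm_sq, ← Complex.ofReal_mul, Complex.ofReal_re]
      split_ifs <;> ring
    simp only [dotProduct, Matrix.mulVec_diagonal, Complex.re_sum, this]
    rw [← Finset.mul_sum, Finset.sum_add_distrib, Finset.sum_ite_eq', Finset.sum_ite_eq']
    simp
  rw [chiralMajorant, Matrix.add_mulVec, dotProduct_add, Complex.add_re, hd, Matrix.smul_mulVec,
    dotProduct_smul, Complex.smul_re, Matrix.add_mulVec, dotProduct_add, Complex.add_re,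
    re_dotProduct_chiral, re_dotProduct_chiral, Circle.coe_exp, Complex.exp_pi_mul_I,
    Circle.coe_one, neg_mul, neg_mul, mul_neg, Complex.neg_re, smul_eq_mul]
  simp only [one_mul]
  ring

theorem re_dotProduct_chiral_le (p : ℕ) (κ : Circle) (x : ZMod q → ℂ) :
    (star x ⬝ᵥ (chiral p q κ).mulVec x).re ≤ (star x ⬝ᵥ (chiralMajorant p q).mulVec x).re := by
  rw [re_dotProduct_chiral, re_dotProduct_chiralMajorant, mul_add]
  have h1 := Complex.re_le_norm ((starRingEnd ℂ) (x 0) * (κ * coupling p q * x 1))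
  rw [norm_mul, norm_mul, norm_mul, Circle.norm_coe, Complex.norm_conj, one_mul] at h1
  -- The corner term is absorbed by 2‖x 0‖‖x 1‖ ≤ ‖x 0‖² + ‖x 1‖².
  nlinarith [mul_nonneg (norm_nonneg (coupling p q)) (sq_nonneg (‖x 0‖ - ‖x 1‖))]

theorem sum_abs_chiral_eigenvalues_sub_le (p : ℕ) :
    ∑ i, |(chiral_isHermitian (q := q) p 1).eigenvalues i -
      (chiral_isHermitian p (Circle.exp Real.pi)).eigenvalues i| ≤ 4 * Real.pi / q := by
  refine (sum_abs_eigenvalues_sub_le _ _ (chiralMajorant_isHermitian p)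
    (re_dotProduct_chiral_le p _) (re_dotProduct_chiral_le p _)).trans ?_
  rw [trace_chiralMajorant, mul_div_assoc]
  exact mul_le_mul_of_nonneg_left (norm_coupling_le p) (by norm_num)

end Representations

end Harper

namespace Harper

/-! ### From Floquet matrices to the operator on ℓ²(ℤ). -/

section Sequences

open Polynomial

/-- The Harper operator on all sequences. -/
def seqH (α θ : ℝ) : Module.End ℂ (ℤ → ℂ) where
  toFun φ n := φ (n - 1) + φ (n + 1) + (potential α θ n : ℂ) * φ n
  map_add' φ ψ := by
    funext n
    simp only [Pi.add_apply]
    ring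
  map_smul' c φ := by
    funext n
    simp only [Pi.smul_apply, smul_eq_mul, RingHom.id_apply]
    ring

theorem seqH_apply (α θ : ℝ) (φ : ℤ → ℂ) (n : ℤ) :
    seqH α θ φ n = φ (n - 1) + φ (n + 1) + (potential α θ n : ℂ) * φ n := rfl

theorem aeval_intertwine {V W : Type*} [AddCommGroup V] [Module ℂ V] [AddCommGroup W] [Module ℂ W]
    (J : V →ₗ[ℂ] W) (A : Module.End ℂ V) (B : Module.End ℂ W) (h : ∀ x, B (J x) = J (A x))
    (P : ℂ[X]) (x : V) : aeval B P (J x) = J (aeval A P x) := by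
  have hpow : ∀ (k : ℕ) (x : V), (B ^ k) (J x) = J ((A ^ k) x) := by
    intro k
    induction k with
    | zero => intro x; rfl
    | succ k ih =>
      intro x
      rw [pow_succ, pow_succ, Module.End.mul_apply, Module.End.mul_apply, h, ih]
  induction P using Polynomial.induction_on' with
  | add P Q hP hQ => simp only [map_add, LinearMap.add_apply, hP, hQ]
  | monomial k a =>
    rw [aeval_monomial, aeval_monomial, Module.End.mul_apply, Module.End.mul_apply, hpow,
      Module.algebraMap_end_apply, Module.algebraMap_end_apply, map_smul]

/-- The evaluation of sequences at `m`. -/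
def evalAt (m : ℤ) : (ℤ → ℂ) →ₗ[ℂ] ℂ := LinearMap.proj m

/-- The span of the point evaluations. -/
def evalSpan : Submodule ℂ ((ℤ → ℂ) →ₗ[ℂ] ℂ) :=
  Submodule.span ℂ (Set.range evalAt)

theorem evalAt_apply (m : ℤ) (φ : ℤ → ℂ) : evalAt m φ = φ m := rfl

theorem evalAt_mem_evalSpan (m : ℤ) : evalAt m ∈ evalSpan :=
  Submodule.subset_span ⟨m, rfl⟩

theorem comp_seqH_mem (α θ : ℝ) {f : (ℤ → ℂ) →ₗ[ℂ] ℂ} (hf : f ∈ evalSpan) :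
    f ∘ₗ seqH α θ ∈ evalSpan := by
  refine Submodule.span_induction (p := fun g _ => g ∘ₗ seqH α θ ∈ evalSpan) ?_ ?_ ?_ ?_ hf
  · rintro _ ⟨m, rfl⟩
    have : evalAt m ∘ₗ seqH α θ = evalAt (m - 1) + evalAt (m + 1)
        + (potential α θ m : ℂ) • evalAt m := rfl
    rw [this]
    exact add_mem (add_mem (evalAt_mem_evalSpan _) (evalAt_mem_evalSpan _))
      (Submodule.smul_mem _ _ (evalAt_mem_evalSpan _))
  · rw [LinearMap.zero_comp]; exact zero_mem _
  · intro x y _ _ hx hy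
    rw [LinearMap.add_comp]; exact add_mem hx hy
  · intro c x _ hx
    rw [LinearMap.smul_comp]; exact Submodule.smul_mem _ _ hx

theorem comp_aeval_seqH_mem (α θ : ℝ) (P : ℂ[X]) {f : (ℤ → ℂ) →ₗ[ℂ] ℂ} (hf : f ∈ evalSpan) :
    f ∘ₗ aeval (seqH α θ) P ∈ evalSpan := by
  have hpow : ∀ (k : ℕ), f ∘ₗ (seqH α θ ^ k) ∈ evalSpan := by
    intro k
    induction k with
    | zero => exact hf
    | succ k ih =>
      rw [pow_succ, Module.End.mul_eq_comp, ← LinearMap.comp_assoc]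
      exact comp_seqH_mem α θ ih
  induction P using Polynomial.induction_on' with
  | add P Q hP hQ =>
    rw [map_add, LinearMap.comp_add]
    exact add_mem hP hQ
  | monomial k a =>
    rw [aeval_monomial, ← Algebra.smul_def, LinearMap.comp_smul]
    exact Submodule.smul_mem _ _ (hpow k)

/-- The character `μ ↦ μ ^ m` of the circle. -/
def circleChar (m : ℤ) : Circle →* ℂ := Circle.coeHom.comp (zpowGroupHom m)

theorem circleChar_injective : Function.Injective circleChar := by
  intro m k hmk
  by_contra hne
  have hd : ((m - k : ℤ) : ℝ) ≠ 0 := by exact_mod_cast sub_ne_zero.2 hne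
  -- The test point is chosen so that its (m - k)-th power is -1.
  have h1 : Circle.exp (Real.pi / (m - k : ℤ)) ^ m = Circle.exp (Real.pi / (m - k : ℤ)) ^ k :=
    Circle.coe_injective (DFunLike.congr_fun hmk _)
  have h2 : Circle.exp (Real.pi / (m - k : ℤ)) ^ (m - k) = 1 := by
    rw [zpow_sub, h1, mul_inv_cancel]
  rw [← Circle.exp_zsmul, zsmul_eq_mul, mul_div_cancel₀ _ hd] at h2
  have h3 := congrArg (fun z : Circle => (z : ℂ)) h2
  simp only [Circle.coe_exp, Complex.exp_pi_mul_I, Circle.coe_one] at h3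
  norm_num at h3

/-- A finite combination of point evaluations that vanishes on exponentials is zero. -/
theorem eq_zero_of_mem_evalSpan {f : (ℤ → ℂ) →ₗ[ℂ] ℂ} (hf : f ∈ evalSpan)
    (h : ∀ μ : Circle, f (fun m => ((μ ^ m : Circle) : ℂ)) = 0) : f = 0 := by
  obtain ⟨c, rfl⟩ := Finsupp.mem_span_range_iff_exists_finsupp.1 hf
  -- Dedekind's independence of characters.
  have hli : LinearIndependent ℂ fun m : ℤ => (circleChar m : Circle → ℂ) :=
    (linearIndependent_monoidHom Circle ℂ).comp circleChar circleChar_injective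
  have hc : c = 0 := by
    refine linearIndependent_iff.1 hli c ?_
    funext μ
    have := h μ
    rw [Finsupp.sum, LinearMap.sum_apply] at this
    rw [Finsupp.linearCombination_apply, Finsupp.sum, Finset.sum_apply]
    exact this
  rw [hc, Finsupp.sum_zero_index]

variable {q : ℕ} [NeZero q]

/-- The sequence with Floquet multiplier `μ ^ q` attached to a vector. -/
def bloch (μ : Circle) : (ZMod q → ℂ) →ₗ[ℂ] (ℤ → ℂ) where
  toFun x m := ((μ ^ m : Circle) : ℂ) * x m
  map_add' x y := by
    funext m
    simp only [Pi.add_apply]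
    ring
  map_smul' c x := by
    funext m
    simp only [Pi.smul_apply, smul_eq_mul, RingHom.id_apply]
    ring

theorem floquet_mulVec (p : ℕ) (θ : ℝ) (μ : Circle) (x : ZMod q → ℂ) (m : ℤ) :
    (floquet p q θ μ).mulVec x m = μ * x (m + 1) + (μ : ℂ)⁻¹ * x (m - 1) +
      (potential (p / q) θ m : ℂ) * x m := by
  have hinv : Matrix.mulVec (((weightedShift fun _ : ZMod q => μ)⁻¹ :
      Matrix.unitaryGroup (ZMod q) ℂ) : Matrix (ZMod q) (ZMod q) ℂ) x m =
      (μ : ℂ)⁻¹ * x (m - 1) := by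
    rw [Matrix.UnitaryGroup.inv_val]
    simp only [Matrix.mulVec, dotProduct, Matrix.star_apply, weightedShift_apply]
    rw [Finset.sum_eq_single ((m : ZMod q) - 1)]
    · rw [if_pos (sub_add_cancel _ _).symm, Complex.star_def, ← Circle.coe_inv_eq_conj,
        Circle.coe_inv]
    · intro b _ hb
      have : (m : ZMod q) ≠ b + 1 := fun h => hb (by rw [h, add_sub_cancel_right])
      simp [this]
    · simp
  have hdiag : ∀ d : ZMod q → Circle, Matrix.mulVec ((diagonalUnitary d :
      Matrix.unitaryGroup (ZMod q) ℂ) : Matrix (ZMod q) (ZMod q) ℂ) x m = d m * x m :=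
    fun d => Matrix.mulVec_diagonal _ _ _
  have hdiag' : ∀ d : ZMod q → Circle, Matrix.mulVec (((diagonalUnitary d)⁻¹ :
      Matrix.unitaryGroup (ZMod q) ℂ) : Matrix (ZMod q) (ZMod q) ℂ) x m = (d m : ℂ)⁻¹ * x m := by
    intro d
    rw [Matrix.UnitaryGroup.inv_val]
    change Matrix.mulVec (Matrix.conjTranspose (Matrix.diagonal fun i => (d i : ℂ))) x m = _
    rw [Matrix.diagonal_conjTranspose, Matrix.mulVec_diagonal, Pi.star_apply, Complex.star_def,
      ← Circle.coe_inv_eq_conj, Circle.coe_inv]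
  have hpot : ((potential (p / q) θ m : ℝ) : ℂ) =
      ((Circle.exp (2 * Real.pi * θ) * phase p q m : Circle) : ℂ) +
        ((Circle.exp (2 * Real.pi * θ) * phase p q m : Circle) : ℂ)⁻¹ := by
    rw [phase_intCast, ← Circle.exp_add, coe_exp_add_inv, potential]
    congr 3
    ring
  rw [floquet, weylSum, Matrix.add_mulVec, Matrix.add_mulVec, Matrix.add_mulVec, Pi.add_apply,
    Pi.add_apply, Pi.add_apply, hinv, hdiag, hdiag', weightedShift_mulVec, hpot]
  ring

theorem seqH_bloch (p : ℕ) (θ : ℝ) (μ : Circle) (x : ZMod q → ℂ) :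
    seqH (p / q) θ (bloch μ x) = bloch μ ((floquet p q θ μ).mulVec x) := by
  funext m
  have hμ : (μ : ℂ) ≠ 0 := Circle.coe_ne_zero μ
  simp only [seqH_apply, bloch, LinearMap.coe_mk, AddHom.coe_mk, floquet_mulVec, Circle.coe_zpow]
  rw [zpow_sub_one₀ hμ, zpow_add_one₀ hμ]
  push_cast
  ring

/-- The discriminant polynomial. -/
def discr (p q : ℕ) [NeZero q] : ℂ[X] := (chiral p q 1).charpoly + C 4

/-- Cayley–Hamilton applied to Chambers' formula. -/
theorem aeval_floquet_discr {p : ℕ} (hpq : p.Coprime q) (θ : ℝ) (μ : Circle) :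
    aeval (floquet p q θ μ) (discr p q) = algebraMap ℂ _ (((μ ^ q : Circle) : ℂ)
      + ((μ ^ q : Circle) : ℂ)⁻¹ + ((2 * Real.cos (2 * Real.pi * (q * θ)) : ℝ) : ℂ)) := by
  have h := Matrix.aeval_self_charpoly (floquet p q θ μ)
  rw [charpoly_floquet hpq, map_sub, aeval_C, sub_eq_zero] at h
  exact h

/-- At a fixed n both sides are finite combinations of point evaluations, so it suffices to test φ =
μ^m. These are Bloch waves, on which the Floquet matrix acts. No direct integral decomposition is
needed. -/
theorem aeval_seqH_discr {p : ℕ} (hpq : p.Coprime q) (θ : ℝ) (φ : ℤ → ℂ) (n : ℤ) :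
    aeval (seqH (p / q) θ) (discr p q) φ n = φ (n + q) + φ (n - q)
      + ((2 * Real.cos (2 * Real.pi * (q * θ)) : ℝ) : ℂ) * φ n := by
  set c : ℂ := ((2 * Real.cos (2 * Real.pi * (q * θ)) : ℝ) : ℂ)
  let f : (ℤ → ℂ) →ₗ[ℂ] ℂ := evalAt n ∘ₗ aeval (seqH (p / q) θ) (discr p q)
    - (evalAt (n + q) + evalAt (n - q) + c • evalAt n)
  have hf : f ∈ evalSpan := by
    refine sub_mem (comp_aeval_seqH_mem _ _ _ (evalAt_mem_evalSpan n)) ?_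
    exact add_mem (add_mem (evalAt_mem_evalSpan _) (evalAt_mem_evalSpan _))
      (Submodule.smul_mem _ _ (evalAt_mem_evalSpan _))
  have hf0 : f = 0 := by
    refine eq_zero_of_mem_evalSpan hf fun μ => ?_
    have hμ : (μ : ℂ) ≠ 0 := Circle.coe_ne_zero μ
    have hb : (fun m : ℤ => ((μ ^ m : Circle) : ℂ)) = bloch μ (1 : ZMod q → ℂ) := by
      funext m
      simp [bloch]
    have h1 := aeval_intertwine (bloch μ) (Matrix.toLinAlgEquiv' (floquet p q θ μ))
      (seqH (p / q) θ) (fun x => seqH_bloch p θ μ x) (discr p q) 1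
    rw [aeval_algHom_apply (Matrix.toLinAlgEquiv' (R := ℂ) (n := ZMod q)), aeval_floquet_discr hpq,
      AlgEquiv.commutes,
      Module.algebraMap_end_apply, map_smul, ← hb] at h1
    simp only [f, LinearMap.sub_apply, LinearMap.comp_apply, LinearMap.add_apply,
      LinearMap.smul_apply, evalAt_apply]
    rw [h1]
    simp only [Pi.smul_apply, smul_eq_mul, Circle.coe_zpow, Circle.coe_pow]
    rw [zpow_add₀ hμ, zpow_sub₀ hμ, zpow_natCast]
    ring
  have := LinearMap.congr_fun hf0 φ
  exact sub_eq_zero.1 this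

theorem aeval_H_discr {p : ℕ} (hpq : p.Coprime q) (θ : ℝ) :
    aeval (H (p / q) θ) (discr p q) = (shift q).toContinuousLinearMap
      + (shift (-q)).toContinuousLinearMap
      + ((2 * Real.cos (2 * Real.pi * (q * θ)) : ℝ) : ℂ) • (1 : ℓ²(ℤ, ℂ) →L[ℂ] ℓ²(ℤ, ℂ)) := by
  refine ContinuousLinearMap.ext fun φ => lp.ext (funext fun n => ?_)
  let J : ℓ²(ℤ, ℂ) →ₗ[ℂ] (ℤ → ℂ) := ⟨⟨fun φ => φ, fun _ _ => rfl⟩, fun _ _ => rfl⟩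
  let ρ : (ℓ²(ℤ, ℂ) →L[ℂ] ℓ²(ℤ, ℂ)) →ₐ[ℂ] Module.End ℂ ℓ²(ℤ, ℂ) :=
    { ContinuousLinearMap.toLinearMapRingHom with commutes' := fun _ => rfl }
  have h1 := aeval_intertwine J (ρ (H (p / q) θ))
    (seqH (p / q) θ) (fun x => rfl) (discr p q) φ
  rw [aeval_algHom_apply] at h1
  have h2 := congrFun h1 n
  rw [aeval_seqH_discr hpq] at h2
  exact h2.symm

theorem norm_aeval_H_discr_le {p : ℕ} (hpq : p.Coprime q) (θ : ℝ) :
    ‖aeval (H (p / q) θ) (discr p q)‖ ≤ 4 := by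
  rw [aeval_H_discr hpq]
  refine ContinuousLinearMap.opNorm_le_bound _ (by norm_num) fun φ => ?_
  have h1 : ‖(((2 * Real.cos (2 * Real.pi * (q * θ)) : ℝ) : ℂ) • φ)‖ ≤ 2 * ‖φ‖ := by
    rw [norm_smul, Complex.norm_real, norm_mul, Real.norm_eq_abs, Real.norm_eq_abs, abs_two]
    refine mul_le_mul_of_nonneg_right ?_ (norm_nonneg _)
    linarith [Real.abs_cos_le_one (2 * Real.pi * (q * θ))]
  have h2 := norm_add₃_le (a := shift q φ) (b := shift (-q) φ)
    (c := ((2 * Real.cos (2 * Real.pi * (q * θ)) : ℝ) : ℂ) • φ)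
  rw [LinearIsometry.norm_map, LinearIsometry.norm_map] at h2
  calc _ ≤ ‖φ‖ + ‖φ‖ + _ := h2
    _ ≤ 4 * ‖φ‖ := by linarith

/-- Spectral mapping: D(E) lies in the spectrum of D(H), whose norm is at most 4. -/
theorem norm_eval_discr_le {p : ℕ} (hpq : p.Coprime q) (θ : ℝ) {E : ℂ}
    (hE : E ∈ spectrum ℂ (H (p / q) θ)) : ‖(discr p q).eval E‖ ≤ 4 := by
  have h := spectrum.subset_polynomial_aeval (H (p / q) θ) (discr p q) ⟨E, hE, rfl⟩
  refine (spectrum.norm_le_norm_mul_of_mem h).trans ?_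
  refine (mul_le_of_le_one_right (norm_nonneg _) ?_).trans (norm_aeval_H_discr_le hpq θ)
  exact ContinuousLinearMap.norm_id_le

theorem S_subset {p : ℕ} (hpq : p.Coprime q) : S (p / q) ⊆ {E : ℝ |
    (∏ i, (E - (chiral_isHermitian (q := q) p 1).eigenvalues i)) *
      ∏ i, (E - (chiral_isHermitian (q := q) p (Circle.exp Real.pi)).eigenvalues i) ≤ 0} := by
  intro E hE
  simp only [S, Set.mem_iUnion] at hE
  obtain ⟨θ, -, hE⟩ := hE
  have h := norm_eval_discr_le hpq θ hE
  have heval : ∀ κ : Circle, (chiral p q κ).charpoly.eval (E : ℂ) =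
      ((∏ i, (E - (chiral_isHermitian (q := q) p κ).eigenvalues i) : ℝ) : ℂ) := by
    intro κ
    rw [(chiral_isHermitian (q := q) p κ).charpoly_eq, eval_prod]
    simp
  have hB := heval (Circle.exp Real.pi)
  rw [charpoly_chiral_neg_one hpq, eval_add, eval_C, heval 1] at hB
  rw [discr, eval_add, eval_C, heval 1] at h
  rw [Set.mem_ofPred_eq]
  generalize (∏ i, (E - (chiral_isHermitian (q := q) p 1).eigenvalues i)) = a at *
  generalize (∏ i, (E - (chiral_isHermitian (q := q) p (Circle.exp Real.pi)).eigenvalues i)) = b at *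
  -- Here a = D(E) - 4 and b = D(E) + 4, so |D(E)| ≤ 4 means a ≤ 0 ≤ b.
  have hb : a + 8 = b := by exact_mod_cast hB
  have ha : |a + 4| ≤ 4 := by
    have : ((a : ℂ) + 4) = ((a + 4 : ℝ) : ℂ) := by push_cast; rfl
    rwa [this, Complex.norm_real] at h
  rw [abs_le] at ha
  rw [← hb]
  exact mul_nonpos_of_nonpos_of_nonneg (by linarith) (by linarith)

end Sequences

end Harper

end

theorem theorem1 (p₀ q₀ : ℕ) (hp : 0 < p₀) (hq : 0 < q₀) (hpq : Nat.Coprime p₀ q₀) :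
    MeasureTheory.volume (Harper.S ((p₀ : ℝ) / (q₀ : ℝ))) ≤
      ENNReal.ofReal (4 * Real.pi / (q₀ : ℝ)) := by
  have : NeZero q₀ := ⟨hq.ne'⟩
  refine (MeasureTheory.measure_mono (Harper.S_subset hpq)).trans
    ((Harper.volume_prod_mul_prod_nonpos_le _ _).trans ?_)
  exact ENNReal.ofReal_le_ofReal (Harper.sum_abs_chiral_eigenvalues_sub_le p₀)
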